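/- Let $\mathbb{F}_q$ be a finite field with $q$ elements, let $R=M_{2\times 2}(\mathbb{F}_q)$ with group of units $\mathcal{U}=GL_2(\mathbb{F}_q)$, and let $w:R\to\mathbb{Z}_{\ge 0}$ satisfy $w(0)=0$ and $w(r)>0$ for all $r\neq 0$. Assume that $w$ has maximal symmetry, i.e. $w(ur)=w(ru)=w(r)$ for all $r\in R$ and $u\in\mathcal{U}$. Assume that $w$ is not a scalar multiple of the Hamming weight (which is $0$ at $0$ and $1$ at every nonzero element of $R$). If $q=2$, assume moreover that $w$ is not a scalar multiple of a homogeneous weight, i.e. of a function $h:R\to\mathbb{R}$ with $h(0)=0$ and $h(ur)=h(r)$ for all $r\in R$, $u\in\mathcal{U}$, for which there is a real number $\zeta>0$ such that $\sum_{x\in Rr}h(x)=\zeta\,|Rr|$ for every nonzero $r\in R$. (Writing $w_i$ for the value of $w$ on matrices of rank $i$, these two assumptions say that $w_1\neq w_2$, and that $w_1\neq 2w_2$ if $q=2$.) Then $w$ does not respect duality: there exist $n\geq 1$ and left $R$-submodules $C,D\subseteq R^n$ with $\mathrm{wwe}_C=\mathrm{wwe}_D$ but $\mathrm{wwe}_{\mathcal{R}(C)}\neq\mathrm{wwe}_{\mathcal{R}(D)}$.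 Here, for $E\subseteq R^n$, $$\mathrm{wwe}_E(X,Y)=\sum_{x\in E}X^{\,n w_{\max}-w(x)}\,Y^{\,w(x)},\qquad w(x)=\sum_{i=1}^n w(x_i),\qquad w_{\max}=\max_{r\in R}w(r),$$ and $\mathcal{R}(C)=\{y\in R^n:\ \sum_{i=1}^n x_iy_i=0\text{ for all }x\in C\}$ is the right dual code of $C$. In particular, no nondegeneracy condition is imposed on $w$: the case $q\,w_2=(q+1)\,w_1$ is included. -/

import Mathlib

namespace RingWeight

/-- The left symmetry group of a function `w` on a ring: units `u` with `w (u r) = w r`. -/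
def leftSymmetryGroup {R α : Type*} [Ring R] (w : R → α) : Subgroup Rˣ where
  carrier := {u | ∀ r : R, w (u * r) = w r}
  mul_mem' := by
    intro a b ha hb r
    rw [Units.val_mul, mul_assoc, ha, hb]
  one_mem' := by
    intro r
    simp
  inv_mem' := by
    intro a ha r
    rw [← ha (↑a⁻¹ * r), Units.mul_inv_cancel_left]

/-- The right symmetry group of a function `w` on a ring: units `u` with `w (r u) = w r`. -/
def rightSymmetryGroup {R α : Type*} [Ring R] (w : R → α) : Subgroup Rˣ where
  carrier := {u | ∀ r : R, w (r * u) = w r}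
  mul_mem' := by
    intro a b ha hb r
    rw [Units.val_mul, ← mul_assoc, hb, ha]
  one_mem' := by
    intro r
    simp
  inv_mem' := by
    intro a ha r
    rw [← ha (r * ↑a⁻¹), Units.inv_mul_cancel_right]

/-- Maximal symmetry: both symmetry groups are the whole unit group. -/
def HasMaximalSymmetry {R α : Type*} [Ring R] (w : R → α) : Prop :=
  leftSymmetryGroup w = ⊤ ∧ rightSymmetryGroup w = ⊤

/-- The Hamming weight on a ring. -/
noncomputable def hamming (R : Type*) [Ring R] (r : R) : ℝ :=
  open Classical in if r = 0 then 0 else 1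

/-- `h` is a homogeneous weight of average `ζ > 0` on a finite ring: it vanishes at `0`, it is
invariant under left multiplication by units, and every nonzero principal left ideal `R r`
has average weight `ζ`. -/
def IsHomogeneous {R : Type*} [Ring R] (ζ : ℝ) (h : R → ℝ) : Prop :=
  0 < ζ ∧ h 0 = 0 ∧ leftSymmetryGroup h = ⊤ ∧
    ∀ r : R, r ≠ 0 →
      ∑ᶠ x ∈ (Ideal.span {r} : Ideal R), h x = ζ * (Nat.card (Ideal.span {r} : Ideal R) : ℝ)

/-- The integer-valued weight `w` is a scalar multiple of the real-valued weight `v`. -/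
def IsMultipleOf {R : Type*} (w : R → ℕ) (v : R → ℝ) : Prop :=
  ∃ c : ℝ, ∀ r : R, (w r : ℝ) = c * v r

/-- The weight of a vector: the additive extension of `w` to `R ^ n`. -/
def vecWeight {R : Type*} (w : R → ℕ) {n : ℕ} (v : Fin n → R) : ℕ :=
  ∑ i, w (v i)

/-- The largest value of `w` (a genuine maximum when `R` is finite and nonempty). -/
noncomputable def maxWeight {R : Type*} (w : R → ℕ) : ℕ :=
  ⨆ r, w r

/-- The `w`-weight enumerator `∑ x ∈ C, X ^ (n * w_max - w x) * Y ^ (w x)` of a subset `C` of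
`R ^ n`, where `R` is finite. The variables `X` and `Y` have indices `0` and `1`. -/
noncomputable def weightEnumerator {R : Type*} (w : R → ℕ) {n : ℕ}
    (C : Set (Fin n → R)) : MvPolynomial (Fin 2) ℤ :=
  ∑ᶠ x ∈ C, MvPolynomial.X 0 ^ (n * maxWeight w - vecWeight w x) *
    MvPolynomial.X 1 ^ vecWeight w x

/-- The right dual code `{y | x · y = 0 for all x ∈ C}` of a left linear code `C`, as a right
submodule of `R ^ n`. -/
def rightDual {R : Type*} [Ring R] {n : ℕ} (C : Submodule R (Fin n → R)) :
    Submodule Rᵐᵒᵖ (Fin n → R) where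
  carrier := {y | ∀ x ∈ C, ∑ i, x i * y i = 0}
  add_mem' := by
    intro a b ha hb x hx
    simp only [Pi.add_apply, mul_add, Finset.sum_add_distrib, ha x hx, hb x hx, add_zero]
  zero_mem' := by
    intro x _
    simp
  smul_mem' := by
    intro r y hy x hx
    simp only [Pi.smul_apply, MulOpposite.smul_eq_mul_unop, ← mul_assoc, ← Finset.sum_mul,
      hy x hx, zero_mul]

/-- `w` respects duality: for left linear codes `C`, `D` of the same length `n ≥ 1`, equality of
the `w`-weight enumerators implies equality of those of the right dual codes. -/
def RespectsDuality {R : Type*} [Ring R] (w : R → ℕ) : Prop :=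
  ∀ n : ℕ, 1 ≤ n → ∀ C D : Submodule R (Fin n → R),
    weightEnumerator w (C : Set (Fin n → R)) = weightEnumerator w (D : Set (Fin n → R)) →
      weightEnumerator w (rightDual C : Set (Fin n → R)) =
        weightEnumerator w (rightDual D : Set (Fin n → R))

end RingWeight

/-! ### Reduction to weights depending only on the rank. -/

open Matrix

/-! By maximal symmetry `w` depends only on the rank, with values w₁ and w₂. Consider codes {(X Aᵢ)ᵢ
: X a 2 × 3 matrix} for two lists of 3 × 2 matrices Aᵢ. Both lists are built from the same few
blocks, and the weight of a codeword depends only on the linear relations between the columns x, y,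
z of X. The multiplicities of the blocks are tuned so that the two weights of X agree except on two
sets: x, y ≠ 0 with x, y, z all parallel, and x = 0 with y, z independent. Both sets have (q² -
1)(q² - q) elements, and the codes interchange their values there, so the enumerators agree
(`sum_comp_weightC_eq_weightD`).

A dual word of weight v ≠ 0 with v < 2 min(w₁, w₂) has a single nonzero coordinate r, with Aᵢ r = 0,
so counting such words only needs the numbers of Aᵢ of rank zero and one
(`ncard_rightDual_matrixCode`, `sum_card_mul_eq_zero`). Suppose the dual enumerators agreed too. If
w₁ < 2w₂, taking v = w₁ gives (q + 1)w₁ = q w₂; if w₂ < 2w₁, taking v = w₂ gives (q² - q - 1)w₁ =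
q(q - 1)w₂, the homogeneous ratio. The first equality implies w₂ < 2w₁, hence the second, and the
two are incompatible. If w₁ ≥ 2w₂, the second equality forces q = 2 and `w` homogeneous, which is
excluded. -/

/-- The weight on `2 × 2` matrices that takes the value `a` in rank one and `b` in rank two. -/
noncomputable def rankWeight {F : Type*} [Field F] (a b : ℕ) (M : Matrix (Fin 2) (Fin 2) F) : ℕ :=
  open Classical in if M = 0 then 0 else if M.det = 0 then a else b

theorem exists_unit_mulVec {F : Type*} [Field F] (c : Fin 2 → F) (hc : c ≠ 0) :
    ∃ U : (Matrix (Fin 2) (Fin 2) F)ˣ, c = (U : Matrix (Fin 2) (Fin 2) F) *ᵥ ![1, 0] := by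
  by_cases h : c 0 = 0
  · have h1 : c 1 ≠ 0 := fun h1 => hc (by ext i; fin_cases i <;> simp [h, h1])
    obtain ⟨U, hU⟩ := (Matrix.isUnit_iff_isUnit_det !![c 0, 1; c 1, 0]).2
      (by simpa [Matrix.det_fin_two] using h1)
    exact ⟨U, by rw [hU]; ext i; fin_cases i <;> simp⟩
  · obtain ⟨U, hU⟩ := (Matrix.isUnit_iff_isUnit_det !![c 0, 0; c 1, 1]).2
      (by simpa [Matrix.det_fin_two] using h)
    exact ⟨U, by rw [hU]; ext i; fin_cases i <;> simp⟩

theorem parallel_of_cross_eq_zero {F : Type*} [Field F] (x y : Fin 2 → F) (hx : x ≠ 0)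
    (h : x 0 * y 1 - x 1 * y 0 = 0) : ∃ t : F, y = t • x := by
  by_cases h0 : x 0 = 0
  · have h1 : x 1 ≠ 0 := fun h1 => hx (by ext i; fin_cases i <;> simp [h0, h1])
    refine ⟨y 1 / x 1, ?_⟩
    have : y 0 = 0 := by simpa [h0, h1] using h
    ext i; fin_cases i
    · simp [h0, this]
    · simp [h1]
  · refine ⟨y 0 / x 0, ?_⟩
    ext i; fin_cases i
    · simp [h0]
    · simp; field_simp; linear_combination h

theorem exists_vecMulVec_of_det_eq_zero {F : Type*} [Field F] (M : Matrix (Fin 2) (Fin 2) F)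
    (h0 : M ≠ 0) (hM : M.det = 0) :
    ∃ c p : Fin 2 → F, c ≠ 0 ∧ p ≠ 0 ∧ M = vecMulVec c p := by
  rw [Matrix.det_fin_two] at hM
  by_cases h : M 0 = 0
  · refine ⟨![0, 1], M 1, fun h => by simpa using congrFun h 1, fun h1 => h0 ?_, ?_⟩
    · ext i j; fin_cases i
      · exact congrFun h j
      · exact congrFun h1 j
    · ext i j; fin_cases i
      · simpa [vecMulVec] using congrFun h j
      · simp [vecMulVec]
  · obtain ⟨t, ht⟩ := parallel_of_cross_eq_zero (M 0) (M 1) h (by linear_combination hM)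
    refine ⟨![1, t], M 0, fun h => by simpa using congrFun h 0, h, ?_⟩
    ext i j; fin_cases i
    · simp [vecMulVec]
    · simpa [vecMulVec] using congrFun ht j

/-- A rank-one matrix is a column times a row, and units act transitively on nonzero vectors, so
both factors can be moved to the first basis vector. -/
theorem exists_units_of_det_eq_zero {F : Type*} [Field F] (M : Matrix (Fin 2) (Fin 2) F)
    (h0 : M ≠ 0) (hM : M.det = 0) :
    ∃ U V : (Matrix (Fin 2) (Fin 2) F)ˣ,
      M = (U : Matrix (Fin 2) (Fin 2) F) * !![1, 0; 0, 0] * (V : Matrix (Fin 2) (Fin 2) F) := by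
  obtain ⟨c, p, hc, hp, rfl⟩ := exists_vecMulVec_of_det_eq_zero M h0 hM
  obtain ⟨U, hU⟩ := exists_unit_mulVec c hc
  obtain ⟨V, hV⟩ := exists_unit_mulVec p hp
  have hV' : IsUnit ((V : Matrix (Fin 2) (Fin 2) F)ᵀ) := by
    rw [Matrix.isUnit_transpose]; exact V.isUnit
  obtain ⟨V', hV'⟩ := hV'
  refine ⟨U, V', ?_⟩
  rw [hV', hU, hV]
  ext i j
  simp [vecMulVec, Matrix.mul_apply, Fin.sum_univ_two, mulVec, dotProduct]

namespace RingWeight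

theorem HasMaximalSymmetry.left {R α : Type*} [Ring R] {w : R → α} (h : HasMaximalSymmetry w)
    (u : Rˣ) (r : R) : w (u * r) = w r := by
  have : u ∈ leftSymmetryGroup w := by rw [h.1]; trivial
  exact this r

theorem HasMaximalSymmetry.right {R α : Type*} [Ring R] {w : R → α} (h : HasMaximalSymmetry w)
    (u : Rˣ) (r : R) : w (r * u) = w r := by
  have : u ∈ rightSymmetryGroup w := by rw [h.2]; trivial
  exact this r

theorem HasMaximalSymmetry.eq_rankWeight {F : Type*} [Field F]
    {w : Matrix (Fin 2) (Fin 2) F → ℕ} (h : HasMaximalSymmetry w) (h0 : w 0 = 0) :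
    w = rankWeight (w !![1, 0; 0, 0]) (w 1) := by
  funext M
  unfold rankWeight
  split_ifs with h1 h2
  · rw [h1, h0]
  · obtain ⟨U, V, rfl⟩ := exists_units_of_det_eq_zero M h1 h2
    rw [h.right, h.left]
  · obtain ⟨U, rfl⟩ := (Matrix.isUnit_iff_isUnit_det M).2 (Ne.isUnit h2)
    rw [← mul_one (U : Matrix (Fin 2) (Fin 2) F), h.left]

end RingWeight

/-! ### Numbers of matrices of given rank. -/

section Counting

variable {F : Type*} [Field F] [Fintype F]

open Classical in
theorem card_det_ne_zero :
    (Finset.univ.filter fun M : Matrix (Fin 2) (Fin 2) F => M.det ≠ 0).card =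
      (Fintype.card F ^ 2 - 1) * (Fintype.card F ^ 2 - Fintype.card F) := by
  have h := Matrix.card_GL_field (𝔽 := F) 2
  simp only [Fin.prod_univ_two, Fin.val_zero, pow_zero, Fin.val_one, pow_one] at h
  rw [← h, Nat.card_eq_fintype_card, ← Finset.card_univ]
  symm
  refine Finset.card_bij (fun U _ => (U : Matrix (Fin 2) (Fin 2) F)) ?_ ?_ ?_
  · intro U _
    simpa using ((Matrix.isUnit_iff_isUnit_det _).1 U.isUnit).ne_zero
  · intro U _ V _ h
    exact Units.ext h
  · intro M hM
    obtain ⟨U, hU⟩ := (Matrix.isUnit_iff_isUnit_det M).2 (Ne.isUnit (by simpa using hM))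
    exact ⟨U, Finset.mem_univ _, hU⟩

open Classical in
theorem card_det_eq_zero :
    (Finset.univ.filter fun M : Matrix (Fin 2) (Fin 2) F => M ≠ 0 ∧ M.det = 0).card =
      (Fintype.card F ^ 2 - 1) * (Fintype.card F + 1) := by
  have h1 := card_det_ne_zero (F := F)
  have h2 : (Finset.univ.filter fun M : Matrix (Fin 2) (Fin 2) F => M ≠ 0 ∧ M.det = 0).card + 1 +
      (Finset.univ.filter fun M : Matrix (Fin 2) (Fin 2) F => M.det ≠ 0).card =
      Fintype.card F ^ 4 := by
    have h3 : (Finset.univ.filter fun M : Matrix (Fin 2) (Fin 2) F => M ≠ 0 ∧ M.det = 0) =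
        (Finset.univ.filter fun M : Matrix (Fin 2) (Fin 2) F => M.det = 0).erase 0 := by
      ext M; simp
    rw [h3, Finset.card_erase_add_one (by simp), Finset.card_filter_add_card_filter_not,
      Finset.card_univ, Fintype.card_congr (Matrix.of (m := Fin 2) (n := Fin 2) (α := F)).symm]
    simp [← pow_mul]
  -- Writing q = p + 1 removes the truncated subtractions; the same substitution is used throughout.
  obtain ⟨p, hp⟩ : ∃ p, Fintype.card F = p + 1 := ⟨_, (Nat.succ_pred Fintype.card_ne_zero).symm⟩
  rw [h1, hp] at h2
  rw [hp]
  have e1 : (p + 1) ^ 2 - 1 = p ^ 2 + 2 * p := by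
    rw [show (p + 1) ^ 2 = p ^ 2 + 2 * p + 1 by ring]; rfl
  have e2 : (p + 1) ^ 2 - (p + 1) = p ^ 2 + p := by
    rw [show (p + 1) ^ 2 = p ^ 2 + p + (p + 1) by ring]; simp
  rw [e1, e2] at h2
  rw [e1]
  nlinarith

open Classical in
theorem card_row_zero_eq_zero :
    (Finset.univ.filter fun M : Matrix (Fin 2) (Fin 2) F => M 0 = 0 ∧ M ≠ 0).card =
      Fintype.card F ^ 2 - 1 := by
  have h : (Finset.univ.filter fun v : Fin 2 → F => v ≠ 0).card = Fintype.card F ^ 2 - 1 := by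
    rw [show (Finset.univ.filter fun v : Fin 2 → F => v ≠ 0) = Finset.univ.erase 0 by ext; simp,
      Finset.card_erase_of_mem (Finset.mem_univ _), Finset.card_univ]
    simp
  rw [← h]
  symm
  refine Finset.card_bij (fun v _ => (Matrix.of ![0, v] : Matrix (Fin 2) (Fin 2) F)) ?_ ?_ ?_
  · intro v hv
    simp only [Finset.mem_filter, Finset.mem_univ, true_and] at hv ⊢
    exact ⟨rfl, fun h => hv (congrFun h 1)⟩
  · intro v _ v' _ h
    exact congrFun h 1
  · intro M hM
    simp only [Finset.mem_filter, Finset.mem_univ, true_and] at hM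
    have : Matrix.of ![0, M 1] = M := by
      ext i j; fin_cases i
      · exact (congrFun hM.1 j).symm
      · rfl
    refine ⟨M 1, ?_, this⟩
    simp only [Finset.mem_filter, Finset.mem_univ, true_and]
    intro h1
    apply hM.2
    rw [← this, h1]
    ext i j; fin_cases i <;> rfl

end Counting

/-! ### Codes parametrised by 2 × 3 matrices, and their light dual words. -/

namespace RingWeight

/-- The left linear code of all vectors `(X * A i)ᵢ`, for `X` a `2 × 3` matrix. -/
def matrixCode {F : Type*} [Field F] {n : ℕ} (A : Fin n → Matrix (Fin 3) (Fin 2) F) :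
    Submodule (Matrix (Fin 2) (Fin 2) F) (Fin n → Matrix (Fin 2) (Fin 2) F) where
  carrier := Set.range fun (X : Matrix (Fin 2) (Fin 3) F) i => X * A i
  add_mem' := by
    rintro _ _ ⟨X, rfl⟩ ⟨Y, rfl⟩
    exact ⟨X + Y, funext fun i => Matrix.add_mul _ _ _⟩
  zero_mem' := ⟨0, funext fun i => Matrix.zero_mul _⟩
  smul_mem' := by
    rintro r _ ⟨X, rfl⟩
    exact ⟨r * X, funext fun i => Matrix.mul_assoc _ _ _⟩

/-- `hA` makes X ↦ (X Aᵢ)ᵢ injective, so summing over codewords is summing over X. -/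
theorem weightEnumerator_matrixCode {F : Type*} [Field F] [Fintype F] {n : ℕ}
    (w : Matrix (Fin 2) (Fin 2) F → ℕ) (A : Fin n → Matrix (Fin 3) (Fin 2) F)
    (hA : ∀ X : Matrix (Fin 2) (Fin 3) F, (∀ i, X * A i = 0) → X = 0) :
    weightEnumerator w (matrixCode A : Set (Fin n → Matrix (Fin 2) (Fin 2) F)) =
      ∑ X : Matrix (Fin 2) (Fin 3) F,
        MvPolynomial.X 0 ^ (n * maxWeight w - ∑ i, w (X * A i)) *
          MvPolynomial.X 1 ^ (∑ i, w (X * A i)) := by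
  have hinj : Function.Injective fun (X : Matrix (Fin 2) (Fin 3) F) i => X * A i := by
    intro X Y h
    rw [← sub_eq_zero]
    refine hA _ fun i => ?_
    rw [Matrix.sub_mul, sub_eq_zero]
    exact congrFun h i
  unfold weightEnumerator
  rw [show (matrixCode A : Set (Fin n → Matrix (Fin 2) (Fin 2) F)) =
    Set.range fun (X : Matrix (Fin 2) (Fin 3) F) i => X * A i from rfl, finsum_mem_range hinj,
    finsum_eq_sum_of_fintype]
  rfl

theorem mem_rightDual_matrixCode {F : Type*} [Field F] {n : ℕ}
    (A : Fin n → Matrix (Fin 3) (Fin 2) F) (y : Fin n → Matrix (Fin 2) (Fin 2) F) :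
    y ∈ rightDual (matrixCode A) ↔ ∑ i, A i * y i = 0 := by
  have key : ∀ X : Matrix (Fin 2) (Fin 3) F,
      ∑ i, X * A i * y i = X * ∑ i, A i * y i := by
    intro X
    rw [Matrix.mul_sum]
    exact Finset.sum_congr rfl fun i _ => Matrix.mul_assoc _ _ _
  constructor
  · intro h
    ext a b
    -- Both rows of this X are the `a`-th unit vector, so the product reads off row `a`.
    have h1 := h _ ⟨Matrix.of fun _ k => if k = a then 1 else 0, rfl⟩
    rw [key] at h1
    simpa [Matrix.mul_apply] using congrFun (congrFun h1 0) b
  · rintro h _ ⟨X, rfl⟩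
    exact (key X).trans (by rw [h, Matrix.mul_zero])

/-- Specialising the first variable to 1 turns the number of words of weight `v` into a coefficient.
-/
theorem ncard_eq_of_weightEnumerator_eq {R : Type*} [Finite R] {w : R → ℕ} {n : ℕ}
    {S T : Set (Fin n → R)} (h : weightEnumerator w S = weightEnumerator w T) (v : ℕ) :
    {y ∈ S | vecWeight w y = v}.ncard = {y ∈ T | vecWeight w y = v}.ncard := by
  classical
  have key : ∀ U : Set (Fin n → R),
      ((MvPolynomial.aeval ![(1 : Polynomial ℤ), Polynomial.X] (weightEnumerator w U)).coeff v) =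
        ({y ∈ U | vecWeight w y = v}.ncard : ℤ) := by
    intro U
    have hU : U.Finite := U.toFinite
    unfold weightEnumerator
    rw [finsum_mem_eq_finite_toFinset_sum _ hU, map_sum, Polynomial.finsetSum_coeff]
    simp only [map_mul, map_pow, MvPolynomial.aeval_X, Matrix.cons_val_zero, one_pow, one_mul,
      Matrix.cons_val_one, Polynomial.coeff_X_pow]
    rw [Finset.sum_ite, Finset.sum_const_zero, add_zero, Finset.sum_const, nsmul_eq_mul, mul_one,
      ← Set.ncard_coe_finset]
    congr 2
    ext y
    simp [eq_comm]
  have := key S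
  rw [h, key T] at this
  exact_mod_cast this.symm

-- Two nonzero coordinates would already weigh more than `v`, so the dual words of weight `v` are
-- exactly those supported at one coordinate.
open Classical in
theorem ncard_rightDual_matrixCode {F : Type*} [Field F] [Fintype F] {n : ℕ}
    {w : Matrix (Fin 2) (Fin 2) F → ℕ} (A : Fin n → Matrix (Fin 3) (Fin 2) F) {v : ℕ}
    (hv : v ≠ 0) (h0 : w 0 = 0) (hw : ∀ r, r ≠ 0 → v < 2 * w r) :
    {y ∈ (rightDual (matrixCode A) : Set (Fin n → Matrix (Fin 2) (Fin 2) F)) |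
        vecWeight w y = v}.ncard =
      ∑ i, (Finset.univ.filter fun r : Matrix (Fin 2) (Fin 2) F => w r = v ∧ A i * r = 0).card := by
  rw [← Finset.card_sigma, ← Set.ncard_coe_finset]
  symm
  refine Set.ncard_congr (fun p _ => Pi.single p.1 p.2) ?_ ?_ ?_
  · rintro ⟨i, r⟩ hr
    simp only [Finset.coe_sigma, Set.mem_sigma_iff, Finset.coe_filter, Finset.mem_univ, true_and,
      Set.mem_ofPred_eq, Finset.coe_univ, Set.mem_univ] at hr
    refine ⟨(mem_rightDual_matrixCode A _).2 ?_, ?_⟩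
    · rw [Finset.sum_eq_single i]
      · simpa using hr.2
      · intro j _ hj
        simp [hj]
      · simp
    · unfold vecWeight
      rw [Finset.sum_eq_single i]
      · simpa using hr.1
      · intro j _ hj
        simp [hj, h0]
      · simp
  · rintro ⟨i, r⟩ ⟨j, s⟩ hr hs h
    simp only [Finset.coe_sigma, Set.mem_sigma_iff, Finset.coe_filter, Finset.mem_univ, true_and,
      Set.mem_ofPred_eq, Finset.coe_univ, Set.mem_univ] at hr hs h
    have hr0 : r ≠ 0 := fun h => hv (by rw [← hr.1, h, h0])
    have hij : i = j := by
      by_contra hij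
      have := congrFun h i
      rw [Pi.single_eq_same, Pi.single_eq_of_ne hij] at this
      exact hr0 this
    subst hij
    rw [Pi.single_injective i h]
  · rintro y ⟨hy, hyv⟩
    obtain ⟨i, hi⟩ : ∃ i, w (y i) ≠ 0 := by
      by_contra! hc
      exact hv (by rw [← hyv]; exact Finset.sum_eq_zero fun i _ => hc i)
    have hi0 : y i ≠ 0 := fun h => hi (by rw [h, h0])
    have hy1 : ∀ j, j ≠ i → y j = 0 := by
      intro j hj
      by_contra hj0
      have h1 := hw _ hi0
      have h2 := hw _ hj0
      have h3 : w (y j) + w (y i) ≤ v := by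
        rw [← hyv, vecWeight, ← Finset.sum_pair (f := fun i => w (y i)) hj]
        exact Finset.sum_le_sum_of_subset (Finset.subset_univ _)
      omega
    have hy2 : Pi.single i (y i) = y := by
      funext j
      by_cases hj : j = i
      · subst hj; simp
      · rw [Pi.single_eq_of_ne hj, hy1 j hj]
    refine ⟨⟨i, y i⟩, ?_, hy2⟩
    simp only [Finset.coe_sigma, Set.mem_sigma_iff, Finset.coe_filter, Finset.mem_univ, true_and,
      Set.mem_ofPred_eq, Finset.coe_univ, Set.mem_univ]
    constructor
    · rw [← hyv, vecWeight, Finset.sum_eq_single i]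
      · intro j _ hj
        rw [hy1 j hj, h0]
      · simp
    · have := (mem_rightDual_matrixCode A y).1 hy
      rwa [Finset.sum_eq_single i (by intro j _ hj; rw [hy1 j hj, Matrix.mul_zero]) (by simp)]
        at this

end RingWeight

/-! ### Rearranging sums, and lists with prescribed multiplicities. -/

theorem Finset.sum_comp_eq_of_swap {α M : Type*} [Fintype α] [DecidableEq α] [AddCommMonoid M]
    {f g : α → ℕ} {S T : Finset α} {u v : ℕ} (hST : Disjoint S T) (hcard : S.card = T.card)
    (hfS : ∀ x ∈ S, f x = u) (hgS : ∀ x ∈ S, g x = v) (hfT : ∀ x ∈ T, f x = v)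
    (hgT : ∀ x ∈ T, g x = u) (hfg : ∀ x, x ∉ S → x ∉ T → f x = g x) (φ : ℕ → M) :
    ∑ x, φ (f x) = ∑ x, φ (g x) := by
  rw [← Finset.sum_add_sum_compl (S ∪ T), ← Finset.sum_add_sum_compl (S ∪ T) fun x => φ (g x)]
  congr 1
  · rw [Finset.sum_union hST, Finset.sum_union hST,
      Finset.sum_congr rfl fun x hx => congrArg φ (hfS x hx),
      Finset.sum_congr rfl fun x hx => congrArg φ (hfT x hx),
      Finset.sum_congr rfl fun x hx => congrArg φ (hgS x hx),
      Finset.sum_congr rfl fun x hx => congrArg φ (hgT x hx)]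
    simp only [Finset.sum_const, hcard, add_comm]
  · refine Finset.sum_congr rfl fun x hx => ?_
    rw [Finset.mem_compl, Finset.mem_union, not_or] at hx
    rw [hfg x hx.1 hx.2]

theorem exists_fin_family {ι α : Type*} [Fintype ι] (A : ι → α) {n : ℕ}
    (hn : n = Fintype.card ι) :
    ∃ B : Fin n → α, ∀ g : α → ℕ, ∑ i, g (B i) = ∑ i, g (A i) := by
  let e := (Fintype.equivFinOfCardEq hn.symm).symm
  exact ⟨A ∘ e, fun g => e.sum_comp fun i => g (A i)⟩

/-- A family of `3 × 2` matrices with prescribed multiplicities: `k₀` times the matrices supported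
in the first column, `k₁`, `k₂`, `k₃` times those of them whose first column lies in the first
coordinate plane, second and first coordinate axis, `k₄` times an affine line of matrices of rank
two, and `k₅` times the zero matrix. -/
theorem exists_coordinates (F : Type*) [Field F] [Fintype F] (k₀ k₁ k₂ k₃ k₄ k₅ : ℕ) {n : ℕ}
    (hn : n = k₀ * Fintype.card F ^ 3 + k₁ * Fintype.card F ^ 2 + k₂ * Fintype.card F +
      k₃ * Fintype.card F + k₄ * Fintype.card F + k₅) :
    ∃ A : Fin n → Matrix (Fin 3) (Fin 2) F, ∀ g : Matrix (Fin 3) (Fin 2) F → ℕ,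
      ∑ i, g (A i) = k₀ * ∑ u : F × F × F, g !![u.1, 0; u.2.1, 0; u.2.2, 0] +
        k₁ * ∑ u : F × F, g !![u.1, 0; u.2, 0; 0, 0] + k₂ * ∑ t : F, g !![0, 0; t, 0; 0, 0] +
        k₃ * ∑ t : F, g !![t, 0; 0, 0; 0, 0] + k₄ * ∑ t : F, g !![0, t; 1, 0; 0, 1] +
        k₅ * g 0 := by
  obtain ⟨A, hA⟩ := exists_fin_family
    (Sum.elim (fun i : Fin k₀ × F × F × F => !![i.2.1, 0; i.2.2.1, 0; i.2.2.2, 0])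
      (Sum.elim (fun i : Fin k₁ × F × F => !![i.2.1, 0; i.2.2, 0; 0, 0])
        (Sum.elim (fun i : Fin k₂ × F => !![0, 0; i.2, 0; 0, 0])
          (Sum.elim (fun i : Fin k₃ × F => !![i.2, 0; 0, 0; 0, 0])
            (Sum.elim (fun i : Fin k₄ × F => !![0, i.2; 1, 0; 0, 1])
              (fun _ : Fin k₅ => (0 : Matrix (Fin 3) (Fin 2) F)))))))
    (n := n) (by simp only [hn, Fintype.card_sum, Fintype.card_prod, Fintype.card_fin]; ring)
  refine ⟨A, fun g => ?_⟩
  rw [hA]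
  simp only [Fintype.sum_sum_type, Sum.elim_inl, Sum.elim_inr]
  rw [Fintype.sum_prod_type, Fintype.sum_prod_type, Fintype.sum_prod_type, Fintype.sum_prod_type,
    Fintype.sum_prod_type]
  simp only [Finset.sum_const, Finset.card_univ, Fintype.card_fin, smul_eq_mul, add_assoc]

theorem sum_ite_eq_add {V : Type*} [Fintype V] [DecidableEq V] (v : V) (a b : ℕ) :
    (∑ u, if u = v then a else b) + b = a + Fintype.card V * b := by
  rw [← Finset.add_sum_erase _ _ (Finset.mem_univ v),
    Finset.sum_congr rfl (g := fun _ => b) (by intro t ht; simp [Finset.ne_of_mem_erase ht])]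
  rw [Finset.sum_const, if_pos rfl, smul_eq_mul, ← Finset.card_univ,
    ← Finset.card_erase_add_one (Finset.mem_univ v)]
  ring

/-! ### Kernels of linear maps into the plane. -/

section Cross

variable {F : Type*} [Field F]

theorem finrank_ker_of_cross_eq_zero {V : Type*} [AddCommGroup V] [Module F V] [FiniteDimensional F V]
    (f : V →ₗ[F] (Fin 2 → F)) (v₀ : V) (h0 : f v₀ ≠ 0)
    (h : ∀ v, f v₀ 0 * f v 1 - f v₀ 1 * f v 0 = 0) :
    Module.finrank F (LinearMap.ker f) + 1 = Module.finrank F V := by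
  have hr : LinearMap.range f = Submodule.span F {f v₀} := by
    apply le_antisymm
    · rintro _ ⟨v, rfl⟩
      obtain ⟨t, ht⟩ := parallel_of_cross_eq_zero _ _ h0 (h v)
      exact Submodule.mem_span_singleton.2 ⟨t, ht.symm⟩
    · rw [Submodule.span_singleton_le_iff_mem]
      exact ⟨v₀, rfl⟩
  have := LinearMap.finrank_range_add_finrank_ker f
  rw [hr, finrank_span_singleton h0] at this
  omega

theorem finrank_ker_of_cross_ne_zero {V : Type*} [AddCommGroup V] [Module F V] [FiniteDimensional F V]
    (f : V →ₗ[F] (Fin 2 → F)) (v₀ v₁ : V) (h : f v₀ 0 * f v₁ 1 - f v₀ 1 * f v₁ 0 ≠ 0) :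
    Module.finrank F (LinearMap.ker f) + 2 = Module.finrank F V := by
  have hr : LinearMap.range f = ⊤ := by
    rw [eq_top_iff]
    intro y _
    set d := f v₀ 0 * f v₁ 1 - f v₀ 1 * f v₁ 0 with hd
    -- The coefficients come from Cramer's rule.
    refine ⟨((y 0 * f v₁ 1 - y 1 * f v₁ 0) / d) • v₀ + ((f v₀ 0 * y 1 - f v₀ 1 * y 0) / d) • v₁, ?_⟩
    rw [map_add, map_smul, map_smul]
    ext i
    fin_cases i <;> simp <;> field_simp <;> rw [hd] <;> ring
  have := LinearMap.finrank_range_add_finrank_ker f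
  rw [hr, finrank_top] at this
  simp at this
  omega

/-- The determinant of the matrix with columns `x` and `y`. -/
def cross (x y : Fin 2 → F) : F := x 0 * y 1 - x 1 * y 0

/-- The linear map `(a, b, c) ↦ a x + b y + c z`. -/
def comb₃ (x y z : Fin 2 → F) : (F × F × F) →ₗ[F] (Fin 2 → F) where
  toFun u := u.1 • x + u.2.1 • y + u.2.2 • z
  map_add' u v := by ext i; simp; ring
  map_smul' r u := by ext i; simp; ring

/-- The linear map `(a, b) ↦ a x + b y`. -/
def comb₂ (x y : Fin 2 → F) : (F × F) →ₗ[F] (Fin 2 → F) where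
  toFun u := u.1 • x + u.2 • y
  map_add' u v := by ext i; simp; ring
  map_smul' r u := by ext i; simp; ring

theorem cross_comb₃ (x y z v : Fin 2 → F) (u : F × F × F) :
    cross v (comb₃ x y z u) = u.1 * cross v x + u.2.1 * cross v y + u.2.2 * cross v z := by
  simp [cross, comb₃]; ring

theorem cross_same (x : Fin 2 → F) : cross x x = 0 := by simp [cross]; ring

end Cross

/-! ### Weight contributed by each block of coordinates. -/

section LinearSums

variable {F : Type*} [Field F] [Fintype F]

theorem sum_ite_eq_zero_of_finrank_ker {V W : Type*} [AddCommGroup V] [Module F V] [Fintype V]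
    [AddCommGroup W] [Module F W] (f : V →ₗ[F] W) [∀ v, Decidable (f v = 0)] (a d e : ℕ)
    (hd : Module.finrank F (LinearMap.ker f) = d) (he : Module.finrank F V = e) :
    (∑ v, if f v = 0 then 0 else a) + a * Fintype.card F ^ d = a * Fintype.card F ^ e := by
  have h1 : Nat.card (LinearMap.ker f) = Fintype.card F ^ d := by
    rw [Module.natCard_eq_pow_finrank (K := F), hd, Nat.card_eq_fintype_card]
  have h2 : Fintype.card V = Fintype.card F ^ e := by
    rw [← Nat.card_eq_fintype_card, Module.natCard_eq_pow_finrank (K := F), he,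
      Nat.card_eq_fintype_card]
  have h3 : Nat.card (LinearMap.ker f) = (Finset.univ.filter fun v => f v = 0).card := by
    exact Nat.subtype_card _ (by simp)
  rw [← h1, ← h2, h3, ← Finset.card_univ,
    ← Finset.card_filter_add_card_filter_not (s := Finset.univ) (fun v => f v = 0),
    Finset.sum_ite, Finset.sum_const_zero, Finset.sum_const, smul_eq_mul]
  ring

open Classical in
/-- The number of vectors outside the kernel of `comb₃ x y z`, multiplied by `a`. -/
noncomputable def sum₃ (a : ℕ) (x y z : Fin 2 → F) : ℕ :=
  ∑ u, if comb₃ x y z u = 0 then 0 else a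

open Classical in
/-- The number of vectors outside the kernel of `comb₂ x y`, multiplied by `a`. -/
noncomputable def sum₂ (a : ℕ) (x y : Fin 2 → F) : ℕ :=
  ∑ u, if comb₂ x y u = 0 then 0 else a

open Classical in
/-- The number of scalars outside the annihilator of `x`, multiplied by `a`. -/
noncomputable def sum₁ (a : ℕ) (x : Fin 2 → F) : ℕ :=
  ∑ t : F, if t • x = 0 then 0 else a

open Classical in
/-- The sum over `t` of the rank weight of the matrix with columns `y` and `t x + z`. -/
noncomputable def affineSum (a b : ℕ) (x y z : Fin 2 → F) : ℕ :=
  ∑ t : F, if y = 0 ∧ t • x + z = 0 then 0 else if cross y (t • x + z) = 0 then a else b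

theorem sum₃_of_cross_ne_zero (a : ℕ) (x y z : Fin 2 → F)
    (h : cross x y ≠ 0 ∨ cross x z ≠ 0 ∨ cross y z ≠ 0) :
    sum₃ a x y z + a * Fintype.card F = a * Fintype.card F ^ 3 := by
  have hV : Module.finrank F (F × F × F) = 3 := by simp
  have key : Module.finrank F (LinearMap.ker (comb₃ x y z)) + 2 = Module.finrank F (F × F × F) := by
    rcases h with h | h | h
    · exact finrank_ker_of_cross_ne_zero _ (1, 0, 0) (0, 1, 0) (by simpa [comb₃, cross] using h)
    · exact finrank_ker_of_cross_ne_zero _ (1, 0, 0) (0, 0, 1) (by simpa [comb₃, cross] using h)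
    · exact finrank_ker_of_cross_ne_zero _ (0, 1, 0) (0, 0, 1) (by simpa [comb₃, cross] using h)
  classical
  have := sum_ite_eq_zero_of_finrank_ker (comb₃ x y z) a 1 3 (by omega) hV
  simpa [sum₃] using this

theorem sum₃_of_cross_eq_zero (a : ℕ) (x y z : Fin 2 → F) (hxy : cross x y = 0)
    (hxz : cross x z = 0) (hyz : cross y z = 0) (h : x ≠ 0 ∨ y ≠ 0 ∨ z ≠ 0) :
    sum₃ a x y z + a * Fintype.card F ^ 2 = a * Fintype.card F ^ 3 := by
  have hV : Module.finrank F (F × F × F) = 3 := by simp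
  have hc : ∀ x y : Fin 2 → F, cross x y = 0 → cross y x = 0 := by
    intro x y h; rw [cross] at h ⊢; linear_combination -h
  have key : Module.finrank F (LinearMap.ker (comb₃ x y z)) + 1 = Module.finrank F (F × F × F) := by
    rcases h with h | h | h
    · refine finrank_ker_of_cross_eq_zero _ (1, 0, 0) (by simpa [comb₃] using h) fun v => ?_
      have := cross_comb₃ x y z x v
      rw [hxy, hxz, cross_same] at this
      simpa [cross, comb₃] using this
    · refine finrank_ker_of_cross_eq_zero _ (0, 1, 0) (by simpa [comb₃] using h) fun v => ?_
      have := cross_comb₃ x y z y v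
      rw [hc _ _ hxy, hyz, cross_same] at this
      simpa [cross, comb₃] using this
    · refine finrank_ker_of_cross_eq_zero _ (0, 0, 1) (by simpa [comb₃] using h) fun v => ?_
      have := cross_comb₃ x y z z v
      rw [hc _ _ hxz, hc _ _ hyz, cross_same] at this
      simpa [cross, comb₃] using this
  classical
  have := sum_ite_eq_zero_of_finrank_ker (comb₃ x y z) a 2 3 (by omega) hV
  simpa [sum₃] using this

theorem sum₂_of_cross_ne_zero (a : ℕ) (x y : Fin 2 → F) (h : cross x y ≠ 0) :
    sum₂ a x y + a = a * Fintype.card F ^ 2 := by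
  have hV : Module.finrank F (F × F) = 2 := by simp
  have key := finrank_ker_of_cross_ne_zero (comb₂ x y) (1, 0) (0, 1) (by simpa [comb₂, cross] using h)
  classical
  have := sum_ite_eq_zero_of_finrank_ker (comb₂ x y) a 0 2 (by omega) hV
  simpa [sum₂] using this

theorem sum₂_of_cross_eq_zero (a : ℕ) (x y : Fin 2 → F) (hxy : cross x y = 0)
    (h : x ≠ 0 ∨ y ≠ 0) :
    sum₂ a x y + a * Fintype.card F = a * Fintype.card F ^ 2 := by
  have hV : Module.finrank F (F × F) = 2 := by simp
  rw [cross] at hxy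
  have key : Module.finrank F (LinearMap.ker (comb₂ x y)) + 1 = Module.finrank F (F × F) := by
    rcases h with h | h
    · refine finrank_ker_of_cross_eq_zero _ (1, 0) (by simpa [comb₂] using h) fun v => ?_
      simp [comb₂]
      linear_combination v.2 * hxy
    · refine finrank_ker_of_cross_eq_zero _ (0, 1) (by simpa [comb₂] using h) fun v => ?_
      simp [comb₂]
      linear_combination -v.1 * hxy
  classical
  have := sum_ite_eq_zero_of_finrank_ker (comb₂ x y) a 1 2 (by omega) hV
  simpa [sum₂] using this

theorem sum₁_of_ne_zero (a : ℕ) (x : Fin 2 → F) (h : x ≠ 0) :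
    sum₁ a x + a = a * Fintype.card F := by
  classical
  unfold sum₁
  simp only [smul_eq_zero, h, or_false]
  have := sum_ite_eq_add (0 : F) 0 a
  linarith

/-- As a function of t, `cross y (t • x + z)` is affine with slope `cross y x`, so exactly one t
gives rank one. -/
theorem affineSum_of_cross_ne_zero (a b : ℕ) (x y z : Fin 2 → F) (h : cross y x ≠ 0) :
    affineSum a b x y z + b = a + b * Fintype.card F := by
  classical
  have hy : y ≠ 0 := fun hy => h (by simp [cross, hy])
  have hc : ∀ t : F, cross y (t • x + z) = 0 ↔ t = -cross y z / cross y x := by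
    intro t
    rw [eq_div_iff h, eq_neg_iff_add_eq_zero]
    simp only [cross, Pi.add_apply, Pi.smul_apply, smul_eq_mul]
    constructor <;> intro h <;> linear_combination h
  unfold affineSum
  simp only [hy, false_and, if_false, hc]
  have := sum_ite_eq_add (-cross y z / cross y x) a b
  linarith

theorem affineSum_of_cross_eq_zero (a b : ℕ) (x y z : Fin 2 → F) (hy : y ≠ 0)
    (h : cross y x = 0) (hz : cross y z = 0) :
    affineSum a b x y z = a * Fintype.card F := by
  have hc : ∀ t : F, cross y (t • x + z) = 0 := by
    intro t
    simp only [cross, Pi.add_apply, Pi.smul_apply, smul_eq_mul] at *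
    linear_combination t * h + hz
  unfold affineSum
  simp [hy, hc, mul_comm]

theorem affineSum_of_cross_eq_zero_of_ne (a b : ℕ) (x y z : Fin 2 → F)
    (h : cross y x = 0) (hz : cross y z ≠ 0) :
    affineSum a b x y z = b * Fintype.card F := by
  have hy : y ≠ 0 := fun hy => hz (by simp [cross, hy])
  have hc : ∀ t : F, cross y (t • x + z) ≠ 0 := by
    intro t ht
    apply hz
    simp only [cross, Pi.add_apply, Pi.smul_apply, smul_eq_mul] at *
    linear_combination ht - t * h
  unfold affineSum
  simp [hy, hc, mul_comm]

theorem affineSum_zero_of_forall_ne (a b : ℕ) (x z : Fin 2 → F) (h : ∀ t : F, t • x + z ≠ 0) :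
    affineSum a b x 0 z = a * Fintype.card F := by
  unfold affineSum
  simp [h, cross, mul_comm]

theorem affineSum_zero_of_cross_eq_zero (a b : ℕ) (x z : Fin 2 → F) (hx : x ≠ 0)
    (h : cross x z = 0) :
    affineSum a b x 0 z + a = a * Fintype.card F := by
  classical
  obtain ⟨s, rfl⟩ := parallel_of_cross_eq_zero x z hx h
  have hc : ∀ t : F, t • x + s • x = 0 ↔ t = -s := by
    intro t
    rw [← add_smul, smul_eq_zero, or_iff_left hx, eq_neg_iff_add_eq_zero]
  unfold affineSum
  simp only [hc, true_and, cross, Pi.zero_apply, zero_mul, sub_zero, if_true]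
  have := sum_ite_eq_add (-s) 0 a
  linarith

end LinearSums

/-! ### Equality of the two weight distributions. -/

section FamilyWeight

variable {F : Type*} [Field F] [Fintype F]

/-- The weight of the code word attached to the matrix with columns `x`, `y`, `z`, for the family
of coordinates with multiplicities `k₀`, …, `k₄`. -/
noncomputable def familyWeight (w₁ w₂ k₀ k₁ k₂ k₃ k₄ : ℕ) (x y z : Fin 2 → F) : ℕ :=
  k₀ * sum₃ w₁ x y z + k₁ * sum₂ w₁ x y + k₂ * sum₁ w₁ y + k₃ * sum₁ w₁ x +
    k₄ * affineSum w₁ w₂ x y z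

/-- A coordinate with zero second column yields a singular product, of weight 0 or w₁; only the
affine line can contribute w₂. -/
theorem sum_rankWeight_eq_familyWeight {w₁ w₂ k₀ k₁ k₂ k₃ k₄ k₅ n : ℕ}
    {A : Fin n → Matrix (Fin 3) (Fin 2) F}
    (hA : ∀ g : Matrix (Fin 3) (Fin 2) F → ℕ,
      ∑ i, g (A i) = k₀ * ∑ u : F × F × F, g !![u.1, 0; u.2.1, 0; u.2.2, 0] +
        k₁ * ∑ u : F × F, g !![u.1, 0; u.2, 0; 0, 0] + k₂ * ∑ t : F, g !![0, 0; t, 0; 0, 0] +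
        k₃ * ∑ t : F, g !![t, 0; 0, 0; 0, 0] + k₄ * ∑ t : F, g !![0, t; 1, 0; 0, 1] +
        k₅ * g 0) (X : Matrix (Fin 2) (Fin 3) F) :
    ∑ i, rankWeight w₁ w₂ (X * A i) =
      familyWeight w₁ w₂ k₀ k₁ k₂ k₃ k₄ (X.col 0) (X.col 1) (X.col 2) := by
  classical
  have hcol : ∀ a b c : F, rankWeight w₁ w₂ (X * !![a, 0; b, 0; c, 0]) =
      if a • X.col 0 + b • X.col 1 + c • X.col 2 = 0 then 0 else w₁ := by
    intro a b c
    have h1 : (X * !![a, 0; b, 0; c, 0]).det = 0 := by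
      rw [Matrix.det_fin_two]
      simp [Matrix.mul_apply, Fin.sum_univ_three]
    have h2 : X * !![a, 0; b, 0; c, 0] = 0 ↔ a • X.col 0 + b • X.col 1 + c • X.col 2 = 0 := by
      rw [← Matrix.ext_iff, funext_iff]
      refine forall_congr' fun i => ?_
      simp [Matrix.mul_apply, Fin.sum_univ_three, Fin.forall_fin_two, mul_comm]
    simp only [rankWeight, h1, h2, if_true]
  have hplane : ∀ t : F, rankWeight w₁ w₂ (X * !![0, t; 1, 0; 0, 1]) =
      if X.col 1 = 0 ∧ t • X.col 0 + X.col 2 = 0 then 0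
      else if cross (X.col 1) (t • X.col 0 + X.col 2) = 0 then w₁ else w₂ := by
    intro t
    have h1 : (X * !![0, t; 1, 0; 0, 1]).det = cross (X.col 1) (t • X.col 0 + X.col 2) := by
      rw [Matrix.det_fin_two]
      simp [Matrix.mul_apply, Fin.sum_univ_three, cross]
      ring
    have h2 : X * !![0, t; 1, 0; 0, 1] = 0 ↔ X.col 1 = 0 ∧ t • X.col 0 + X.col 2 = 0 := by
      rw [← Matrix.ext_iff, funext_iff, funext_iff, ← forall_and]
      refine forall_congr' fun i => ?_
      simp [Matrix.mul_apply, Fin.sum_univ_three, Fin.forall_fin_two, mul_comm]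
    simp only [rankWeight, h1, h2]
  rw [hA fun B => rankWeight w₁ w₂ (X * B)]
  simp only [hcol, hplane]
  have h0 : rankWeight w₁ w₂ (X * (0 : Matrix (Fin 3) (Fin 2) F)) = 0 := by simp [rankWeight]
  rw [h0, mul_zero, add_zero]
  unfold familyWeight sum₃ sum₂ sum₁ affineSum comb₃ comb₂
  simp only [LinearMap.coe_mk, AddHom.coe_mk, zero_smul, add_zero, zero_add]

/-- The weights of the first of the two codes, for `|F| = p + 1`. -/
noncomputable def weightC (w₁ w₂ p : ℕ) (x y z : Fin 2 → F) : ℕ :=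
  familyWeight w₁ w₂ ((p + 2) * w₁ + (p + 1) ^ 2 * w₂) ((p + 1) * w₁) ((p + 1) ^ 2 * w₂)
    ((p + 1) ^ 2 * (p + 2) * w₂) 0 x y z

/-- The weights of the second of the two codes, for `|F| = p + 1`. -/
noncomputable def weightD (w₁ w₂ p : ℕ) (x y z : Fin 2 → F) : ℕ :=
  familyWeight w₁ w₂ ((p + 1) * w₁ + (p + 1) ^ 2 * w₂) ((p + 1) * w₂) ((p + 1) ^ 2 * w₁)
    ((p + 1) * (p + 2) * w₁ + (p + 1) ^ 3 * w₂) (p * (p + 1) * w₁) x y z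

variable {p : ℕ} (w₁ w₂ : ℕ) {x y z : Fin 2 → F}

theorem sum₃_rank_two (hp : Fintype.card F = p + 1)
    (h : cross x y ≠ 0 ∨ cross x z ≠ 0 ∨ cross y z ≠ 0) :
    sum₃ w₁ x y z = w₁ * p * (p + 1) * (p + 2) := by
  have := sum₃_of_cross_ne_zero w₁ x y z h
  rw [hp] at this
  linarith

theorem sum₃_rank_one (hp : Fintype.card F = p + 1) (hxy : cross x y = 0) (hxz : cross x z = 0)
    (hyz : cross y z = 0) (h : x ≠ 0 ∨ y ≠ 0 ∨ z ≠ 0) :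
    sum₃ w₁ x y z = w₁ * p * (p + 1) ^ 2 := by
  have := sum₃_of_cross_eq_zero w₁ x y z hxy hxz hyz h
  rw [hp] at this
  linarith

theorem sum₂_rank_two (hp : Fintype.card F = p + 1) (h : cross x y ≠ 0) :
    sum₂ w₁ x y = w₁ * p * (p + 2) := by
  have := sum₂_of_cross_ne_zero w₁ x y h
  rw [hp] at this
  linarith

theorem sum₂_rank_one (hp : Fintype.card F = p + 1) (hxy : cross x y = 0) (h : x ≠ 0 ∨ y ≠ 0) :
    sum₂ w₁ x y = w₁ * p * (p + 1) := by
  have := sum₂_of_cross_eq_zero w₁ x y hxy h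
  rw [hp] at this
  linarith

theorem sum₁_rank_one (hp : Fintype.card F = p + 1) (h : x ≠ 0) : sum₁ w₁ x = w₁ * p := by
  have := sum₁_of_ne_zero w₁ x h
  rw [hp] at this
  linarith

theorem sum₃_zero : sum₃ w₁ (0 : Fin 2 → F) 0 0 = 0 := by simp [sum₃, comb₃]

theorem sum₂_zero : sum₂ w₁ (0 : Fin 2 → F) 0 = 0 := by simp [sum₂, comb₂]

theorem sum₁_zero : sum₁ w₁ (0 : Fin 2 → F) = 0 := by simp [sum₁]

theorem affineSum_zero : affineSum w₁ w₂ (0 : Fin 2 → F) 0 0 = 0 := by simp [affineSum]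

theorem cross_eq_zero_of_parallel {F : Type*} [Field F] {x y z : Fin 2 → F} (hx : x ≠ 0)
    (hxy : cross x y = 0) (hxz : cross x z = 0) : cross y z = 0 := by
  obtain ⟨s, rfl⟩ := parallel_of_cross_eq_zero x y hx hxy
  obtain ⟨t, rfl⟩ := parallel_of_cross_eq_zero x z hx hxz
  simp [cross]
  ring

theorem cross_swap {F : Type*} [Field F] (x y : Fin 2 → F) : cross y x = -cross x y := by
  simp [cross]
  ring

/-- This and the next three lemmas exhibit the swap: the two values here reappear, with the codes
exchanged, when x = 0 and y, z are independent. -/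
theorem weightC_of_parallel (hp : Fintype.card F = p + 1) (hx : x ≠ 0) (hy : y ≠ 0)
    (hxy : cross x y = 0) (hxz : cross x z = 0) :
    weightC w₁ w₂ p x y z =
      w₁ * p * (p + 1) ^ 2 * ((p + 3) * w₁ + ((p + 1) ^ 2 + p + 3) * w₂) := by
  have hyz := cross_eq_zero_of_parallel hx hxy hxz
  simp only [weightC, familyWeight, sum₃_rank_one w₁ hp hxy hxz hyz (.inl hx),
    sum₂_rank_one w₁ hp hxy (.inl hx), sum₁_rank_one w₁ hp hx, sum₁_rank_one w₁ hp hy]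
  ring

theorem weightD_of_parallel (hp : Fintype.card F = p + 1) (hx : x ≠ 0) (hy : y ≠ 0)
    (hxy : cross x y = 0) (hxz : cross x z = 0) :
    weightD w₁ w₂ p x y z = w₁ * p * (p + 1) *
      ((p + 2) * ((p + 2) * w₁ + (p + 1) ^ 2 * w₂) + (p + 1) * (w₁ + w₂)) := by
  have hyz := cross_eq_zero_of_parallel hx hxy hxz
  have hyx : cross y x = 0 := by rw [cross_swap, hxy, neg_zero]
  simp only [weightD, familyWeight, sum₃_rank_one w₁ hp hxy hxz hyz (.inl hx),
    sum₂_rank_one w₁ hp hxy (.inl hx), sum₁_rank_one w₁ hp hx, sum₁_rank_one w₁ hp hy,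
    affineSum_of_cross_eq_zero w₁ w₂ x y z hy hyx hyz, hp]
  ring

theorem weightC_of_zero_of_cross_ne_zero (hp : Fintype.card F = p + 1) (hyz : cross y z ≠ 0) :
    weightC w₁ w₂ p 0 y z = w₁ * p * (p + 1) *
      ((p + 2) * ((p + 2) * w₁ + (p + 1) ^ 2 * w₂) + (p + 1) * (w₁ + w₂)) := by
  have hy : y ≠ 0 := fun hy => hyz (by simp [cross, hy])
  have hxy : cross 0 y = 0 := by simp [cross]
  simp only [weightC, familyWeight, sum₃_rank_two w₁ hp (.inr (.inr hyz)),
    sum₂_rank_one w₁ hp hxy (.inr hy), sum₁_zero, sum₁_rank_one w₁ hp hy]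
  ring

theorem weightD_of_zero_of_cross_ne_zero (hp : Fintype.card F = p + 1) (hyz : cross y z ≠ 0) :
    weightD w₁ w₂ p 0 y z =
      w₁ * p * (p + 1) ^ 2 * ((p + 3) * w₁ + ((p + 1) ^ 2 + p + 3) * w₂) := by
  have hy : y ≠ 0 := fun hy => hyz (by simp [cross, hy])
  have hxy : cross 0 y = 0 := by simp [cross]
  have hyx : cross y 0 = 0 := by simp [cross]
  simp only [weightD, familyWeight, sum₃_rank_two w₁ hp (.inr (.inr hyz)),
    sum₂_rank_one w₁ hp hxy (.inr hy), sum₁_zero, sum₁_rank_one w₁ hp hy,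
    affineSum_of_cross_eq_zero_of_ne w₁ w₂ 0 y z hyx hyz, hp]
  ring

/-- Both weights are determined by which columns vanish and which pairs are parallel; the
multiplicities make every remaining configuration a polynomial identity in p, w₁, w₂. -/
theorem weightC_eq_weightD (hp : Fintype.card F = p + 1)
    (h1 : ¬ (x ≠ 0 ∧ y ≠ 0 ∧ cross x y = 0 ∧ cross x z = 0)) (h2 : ¬ (x = 0 ∧ cross y z ≠ 0)) :
    weightC w₁ w₂ p x y z = weightD w₁ w₂ p x y z := by
  by_cases hxy : cross x y = 0
  swap
  · have hx : x ≠ 0 := fun hx => hxy (by simp [cross, hx])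
    have hy : y ≠ 0 := fun hy => hxy (by simp [cross, hy])
    have hyx : cross y x ≠ 0 := by rwa [cross_swap, neg_ne_zero]
    have ha : affineSum w₁ w₂ x y z = w₁ + w₂ * p := by
      have := affineSum_of_cross_ne_zero w₁ w₂ x y z hyx
      rw [hp] at this
      linarith
    simp only [weightC, weightD, familyWeight, sum₃_rank_two w₁ hp (.inl hxy), ha,
      sum₂_rank_two w₁ hp hxy, sum₁_rank_one w₁ hp hx, sum₁_rank_one w₁ hp hy]
    ring
  have hyx : cross y x = 0 := by rw [cross_swap, hxy, neg_zero]
  by_cases hy : y = 0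
  · subst hy
    by_cases hx : x = 0
    · subst hx
      by_cases hz : z = 0
      · subst hz
        simp only [weightC, weightD, familyWeight, sum₃_zero, sum₂_zero, sum₁_zero, affineSum_zero,
          mul_zero]
      · have h0 : cross 0 z = 0 := by simp [cross]
        have ha := affineSum_zero_of_forall_ne w₁ w₂ 0 z (by simpa using hz)
        simp only [weightC, weightD, familyWeight, sum₃_rank_one w₁ hp hxy h0 h0 (.inr (.inr hz)),
          sum₂_zero, sum₁_zero, ha, hp]
        ring
    · have h0 : cross 0 z = 0 := by simp [cross]
      by_cases hxz : cross x z = 0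
      · have ha : affineSum w₁ w₂ x 0 z = w₁ * p := by
          have := affineSum_zero_of_cross_eq_zero w₁ w₂ x z hx hxz
          rw [hp] at this
          linarith
        simp only [weightC, weightD, familyWeight, sum₃_rank_one w₁ hp hxy hxz h0 (.inl hx),
          sum₂_rank_one w₁ hp hxy (.inl hx), sum₁_zero, sum₁_rank_one w₁ hp hx, ha]
        ring
      · have ha := affineSum_zero_of_forall_ne w₁ w₂ x z (by
          intro t ht
          apply hxz
          rw [eq_neg_of_add_eq_zero_right ht]
          simp [cross]
          ring)
        simp only [weightC, weightD, familyWeight, sum₃_rank_two w₁ hp (.inr (.inl hxz)),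
          sum₂_rank_one w₁ hp hxy (.inl hx), sum₁_zero, sum₁_rank_one w₁ hp hx, ha, hp]
        ring
  · by_cases hx : x = 0
    · have hyz : cross y z = 0 := by_contra fun h => h2 ⟨hx, h⟩
      subst hx
      have h0 : cross 0 z = 0 := by simp [cross]
      simp only [weightC, weightD, familyWeight, sum₃_rank_one w₁ hp hxy h0 hyz (.inr (.inl hy)),
        sum₂_rank_one w₁ hp hxy (.inr hy), sum₁_zero, sum₁_rank_one w₁ hp hy,
        affineSum_of_cross_eq_zero w₁ w₂ 0 y z hy hyx hyz, hp]
      ring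
    · have hxz : cross x z ≠ 0 := fun h => h1 ⟨hx, hy, hxy, h⟩
      have hyz : cross y z ≠ 0 := fun h => hxz (cross_eq_zero_of_parallel hy hyx h)
      simp only [weightC, weightD, familyWeight, sum₃_rank_two w₁ hp (.inr (.inl hxz)),
        sum₂_rank_one w₁ hp hxy (.inl hx), sum₁_rank_one w₁ hp hx, sum₁_rank_one w₁ hp hy,
        affineSum_of_cross_eq_zero_of_ne w₁ w₂ x y z hyx hyz, hp]
      ring

theorem familyWeight_pos {k₀ k₁ k₂ k₃ k₄ : ℕ} (hk : 0 < k₀) (hw : 0 < w₁)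
    (h : ¬ (x = 0 ∧ y = 0 ∧ z = 0)) : 0 < familyWeight w₁ w₂ k₀ k₁ k₂ k₃ k₄ x y z := by
  obtain ⟨u, hu⟩ : ∃ u, comb₃ x y z u ≠ 0 := by
    by_contra! hc
    refine h ⟨?_, ?_, ?_⟩
    · simpa [comb₃] using hc (1, 0, 0)
    · simpa [comb₃] using hc (0, 1, 0)
    · simpa [comb₃] using hc (0, 0, 1)
  have h3 : 0 < sum₃ w₁ x y z := by
    unfold sum₃
    exact Finset.sum_pos' (fun _ _ => Nat.zero_le _) ⟨u, Finset.mem_univ _, by simp [hu, hw]⟩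
  unfold familyWeight
  positivity

-- Choosing x ≠ 0, then a nonzero multiple y and any multiple z, gives (q² - 1)(q - 1)q triples,
-- which is the order of GL₂.
open Classical in
theorem card_parallel_eq_card_zero_col :
    (Finset.univ.filter fun X : Matrix (Fin 2) (Fin 3) F => X.col 0 ≠ 0 ∧ X.col 1 ≠ 0 ∧
      cross (X.col 0) (X.col 1) = 0 ∧ cross (X.col 0) (X.col 2) = 0).card =
    (Finset.univ.filter fun X : Matrix (Fin 2) (Fin 3) F =>
      X.col 0 = 0 ∧ cross (X.col 1) (X.col 2) ≠ 0).card := by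
  have hS : (Finset.univ.filter fun X : Matrix (Fin 2) (Fin 3) F => X.col 0 ≠ 0 ∧ X.col 1 ≠ 0 ∧
      cross (X.col 0) (X.col 1) = 0 ∧ cross (X.col 0) (X.col 2) = 0).card =
      ((Finset.univ.erase (0 : Fin 2 → F)) ×ˢ ((Finset.univ.erase (0 : F)) ×ˢ
        (Finset.univ : Finset F))).card := by
    symm
    refine Finset.card_bij
      (fun u _ => Matrix.of fun i => ![u.1 i, u.2.1 * u.1 i, u.2.2 * u.1 i]) ?_ ?_ ?_
    · rintro ⟨x, s, t⟩ hu
      simp only [Finset.mem_product, Finset.mem_erase, Finset.mem_univ, and_true] at hu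
      simp only [Finset.mem_filter, Finset.mem_univ, true_and]
      have h0 : (Matrix.of fun i => ![x i, s * x i, t * x i]).col 0 = x := rfl
      have h1 : (Matrix.of fun i => ![x i, s * x i, t * x i]).col 1 = s • x := rfl
      have h2 : (Matrix.of fun i => ![x i, s * x i, t * x i]).col 2 = t • x := rfl
      rw [h0, h1, h2]
      refine ⟨hu.1, smul_ne_zero hu.2 hu.1, ?_, ?_⟩ <;> simp [cross] <;> ring
    · rintro ⟨x, s, t⟩ hu ⟨x', s', t'⟩ _ h
      simp only [Finset.mem_product, Finset.mem_erase, Finset.mem_univ, and_true] at hu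
      have h0 : x = x' := congrArg (fun M => M.col 0) h
      have h1 : s • x = s' • x' := congrArg (fun M => M.col 1) h
      have h2 : t • x = t' • x' := congrArg (fun M => M.col 2) h
      subst h0
      rw [smul_left_injective F hu.1 h1, smul_left_injective F hu.1 h2]
    · intro X hX
      simp only [Finset.mem_filter, Finset.mem_univ, true_and] at hX
      obtain ⟨s, hs⟩ := parallel_of_cross_eq_zero _ _ hX.1 hX.2.2.1
      obtain ⟨t, ht⟩ := parallel_of_cross_eq_zero _ _ hX.1 hX.2.2.2
      refine ⟨(X.col 0, s, t), ?_, ?_⟩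
      · simp only [Finset.mem_product, Finset.mem_erase, Finset.mem_univ, and_true]
        refine ⟨hX.1, fun h => hX.2.1 (by rw [hs, h, zero_smul])⟩
      · ext i j
        fin_cases j
        · rfl
        · exact (congrFun hs i).symm
        · exact (congrFun ht i).symm
  have hT : (Finset.univ.filter fun X : Matrix (Fin 2) (Fin 3) F =>
      X.col 0 = 0 ∧ cross (X.col 1) (X.col 2) ≠ 0).card =
      (Finset.univ.filter fun M : Matrix (Fin 2) (Fin 2) F => M.det ≠ 0).card := by
    symm
    refine Finset.card_bij (fun M _ => Matrix.of fun i => ![0, M i 0, M i 1]) ?_ ?_ ?_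
    · intro M hM
      simp only [Finset.mem_filter, Finset.mem_univ, true_and, Matrix.det_fin_two] at hM ⊢
      refine ⟨rfl, fun h => hM ?_⟩
      simp [cross] at h
      linear_combination h
    · intro M _ M' _ h
      ext i j
      fin_cases j
      · exact congrFun (congrFun h i) 1
      · exact congrFun (congrFun h i) 2
    · intro X hX
      simp only [Finset.mem_filter, Finset.mem_univ, true_and] at hX
      refine ⟨Matrix.of fun i => ![X i 1, X i 2], ?_, ?_⟩
      · simp only [Finset.mem_filter, Finset.mem_univ, true_and, Matrix.det_fin_two]
        intro h
        apply hX.2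
        simp [cross] at h ⊢
        linear_combination h
      · ext i j
        fin_cases j
        · exact (congrFun hX.1 i).symm
        · rfl
        · rfl
  rw [hS, hT, card_det_ne_zero, Finset.card_product, Finset.card_product,
    Finset.card_erase_of_mem (Finset.mem_univ _), Finset.card_erase_of_mem (Finset.mem_univ _),
    Finset.card_univ, Finset.card_univ]
  simp only [Fintype.card_fun, Fintype.card_fin]
  congr 1
  rw [Nat.sub_mul, one_mul, pow_two]

theorem sum_comp_weightC_eq_weightD {M : Type*} [AddCommMonoid M] (hp : Fintype.card F = p + 1)
    (φ : ℕ → M) :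
    ∑ X : Matrix (Fin 2) (Fin 3) F, φ (weightC w₁ w₂ p (X.col 0) (X.col 1) (X.col 2)) =
      ∑ X : Matrix (Fin 2) (Fin 3) F, φ (weightD w₁ w₂ p (X.col 0) (X.col 1) (X.col 2)) := by
  classical
  refine Finset.sum_comp_eq_of_swap ?_ (card_parallel_eq_card_zero_col (F := F))
    (u := w₁ * p * (p + 1) ^ 2 * ((p + 3) * w₁ + ((p + 1) ^ 2 + p + 3) * w₂))
    (v := w₁ * p * (p + 1) *
      ((p + 2) * ((p + 2) * w₁ + (p + 1) ^ 2 * w₂) + (p + 1) * (w₁ + w₂))) ?_ ?_ ?_ ?_ ?_ φ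
  · rw [Finset.disjoint_filter]
    exact fun X _ h h' => h.1 h'.1
  · intro X hX
    obtain ⟨-, hx, hy, hxy, hxz⟩ := Finset.mem_filter.1 hX
    exact weightC_of_parallel w₁ w₂ hp hx hy hxy hxz
  · intro X hX
    obtain ⟨-, hx, hy, hxy, hxz⟩ := Finset.mem_filter.1 hX
    exact weightD_of_parallel w₁ w₂ hp hx hy hxy hxz
  · intro X hX
    obtain ⟨-, hx, hyz⟩ := Finset.mem_filter.1 hX
    rw [hx]
    exact weightC_of_zero_of_cross_ne_zero w₁ w₂ hp hyz
  · intro X hX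
    obtain ⟨-, hx, hyz⟩ := Finset.mem_filter.1 hX
    rw [hx]
    exact weightD_of_zero_of_cross_ne_zero w₁ w₂ hp hyz
  · intro X h1 h2
    exact weightC_eq_weightD w₁ w₂ hp (fun h => h1 (Finset.mem_filter.2 ⟨Finset.mem_univ _, h⟩))
      (fun h => h2 (Finset.mem_filter.2 ⟨Finset.mem_univ _, h⟩))

end FamilyWeight

/-! ### Dual words with one nonzero coordinate. -/

section DualCounting

variable {F : Type*} [Field F] [Fintype F]

-- A zero coordinate annihilates every r, a nonzero one supported in the first column those r with
-- zero first row, and one on the affine line only r = 0. Each first-column block contains the zero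
-- matrix once; the extra term on the left compensates for this without subtraction.
open Classical in
theorem sum_card_mul_eq_zero {p k₀ k₁ k₂ k₃ k₄ k₅ n : ℕ} (hp : Fintype.card F = p + 1)
    {A : Fin n → Matrix (Fin 3) (Fin 2) F}
    (hA : ∀ g : Matrix (Fin 3) (Fin 2) F → ℕ,
      ∑ i, g (A i) = k₀ * ∑ u : F × F × F, g !![u.1, 0; u.2.1, 0; u.2.2, 0] +
        k₁ * ∑ u : F × F, g !![u.1, 0; u.2, 0; 0, 0] + k₂ * ∑ t : F, g !![0, 0; t, 0; 0, 0] +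
        k₃ * ∑ t : F, g !![t, 0; 0, 0; 0, 0] + k₄ * ∑ t : F, g !![0, t; 1, 0; 0, 1] +
        k₅ * g 0) (P : Matrix (Fin 2) (Fin 2) F → Prop) [DecidablePred P] (hP : ¬ P 0) :
    (∑ i, (Finset.univ.filter fun r : Matrix (Fin 2) (Fin 2) F => P r ∧ A i * r = 0).card) +
        (k₀ + k₁ + k₂ + k₃) * (Finset.univ.filter fun r => r 0 = 0 ∧ P r).card =
      (k₀ + k₁ + k₂ + k₃ + k₅) * (Finset.univ.filter fun r => P r).card +
        (k₀ * (p + 1) ^ 3 + k₁ * (p + 1) ^ 2 + (k₂ + k₃) * (p + 1)) *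
          (Finset.univ.filter fun r => r 0 = 0 ∧ P r).card := by
  rw [hA fun B => (Finset.univ.filter fun r : Matrix (Fin 2) (Fin 2) F => P r ∧ B * r = 0).card]
  set c₀ := (Finset.univ.filter fun r => P r).card with hc₀
  set c₁ := (Finset.univ.filter fun r => r 0 = 0 ∧ P r).card with hc₁
  have hcol : ∀ a b c : F, (Finset.univ.filter fun r : Matrix (Fin 2) (Fin 2) F =>
      P r ∧ !![a, 0; b, 0; c, 0] * r = 0).card = if a = 0 ∧ b = 0 ∧ c = 0 then c₀ else c₁ := by
    intro a b c
    have key : ∀ r : Matrix (Fin 2) (Fin 2) F, !![a, 0; b, 0; c, 0] * r = 0 ↔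
        (a = 0 ∧ b = 0 ∧ c = 0) ∨ r 0 = 0 := by
      intro r
      rw [← Matrix.ext_iff]
      simp only [Fin.forall_fin_succ, funext_iff, Matrix.mul_apply, Fin.sum_univ_two]
      simp
      tauto
    split_ifs with h
    · rw [hc₀]
      congr 1
      ext r
      simp only [Finset.mem_filter, Finset.mem_univ, true_and, key]
      tauto
    · rw [hc₁]
      congr 1
      ext r
      simp only [Finset.mem_filter, Finset.mem_univ, true_and, key]
      tauto
  have hplane : ∀ t : F, (Finset.univ.filter fun r : Matrix (Fin 2) (Fin 2) F =>
      P r ∧ !![0, t; 1, 0; 0, 1] * r = 0).card = 0 := by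
    intro t
    rw [Finset.card_eq_zero, Finset.filter_eq_empty_iff]
    rintro r - ⟨hr, h⟩
    apply hP
    convert hr
    ext i j
    fin_cases i
    · simpa [Matrix.mul_apply, Fin.sum_univ_two] using (congrFun (congrFun h 1) j).symm
    · simpa [Matrix.mul_apply, Fin.sum_univ_two] using (congrFun (congrFun h 2) j).symm
  simp only [hcol, hplane, Matrix.zero_mul, and_true, true_and, Finset.sum_const_zero, mul_zero,
    add_zero]
  have h3 := sum_ite_eq_add (0 : F × F × F) c₀ c₁
  have h2 := sum_ite_eq_add (0 : F × F) c₀ c₁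
  have h1 := sum_ite_eq_add (0 : F) c₀ c₁
  simp only [Prod.ext_iff, Prod.fst_zero, Prod.snd_zero, Fintype.card_prod, hp] at h1 h2 h3
  zify at h1 h2 h3 ⊢
  linear_combination (k₀ : ℤ) * h3 + (k₁ : ℤ) * h2 + ((k₂ : ℤ) + k₃) * h1

end DualCounting

/-! ### The two codes, and the homogeneous ratio. -/

namespace RingWeight

variable {F : Type*} [Field F] [Fintype F]

/-- In the final equation the factor of `c₀` is the excess of zero coordinates of `A` over `B`. The
factor of `c₁` is the excess of rank-one coordinates of `B` over `A`; it differs from the former by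
p(p + 1)²w₁, the number of rank-two coordinates of `B`. -/
theorem exists_codes (w₁ w₂ : ℕ) (h₁ : 0 < w₁) (h₂ : 0 < w₂) {p : ℕ}
    (hp : Fintype.card F = p + 1) :
    ∃ n : ℕ, 1 ≤ n ∧ ∃ A B : Fin n → Matrix (Fin 3) (Fin 2) F,
      weightEnumerator (rankWeight w₁ w₂) (matrixCode A : Set (Fin n → Matrix (Fin 2) (Fin 2) F)) =
      weightEnumerator (rankWeight w₁ w₂) (matrixCode B : Set (Fin n → Matrix (Fin 2) (Fin 2) F)) ∧
      ∀ v c₀ c₁ : ℕ, v ≠ 0 →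
        (∀ r : Matrix (Fin 2) (Fin 2) F, r ≠ 0 → v < 2 * rankWeight w₁ w₂ r) →
        {r : Matrix (Fin 2) (Fin 2) F | rankWeight w₁ w₂ r = v}.ncard = c₀ →
        {r : Matrix (Fin 2) (Fin 2) F | r 0 = 0 ∧ rankWeight w₁ w₂ r = v}.ncard = c₁ →
        weightEnumerator (rankWeight w₁ w₂)
          (rightDual (matrixCode A) : Set (Fin n → Matrix (Fin 2) (Fin 2) F)) =
        weightEnumerator (rankWeight w₁ w₂)
          (rightDual (matrixCode B) : Set (Fin n → Matrix (Fin 2) (Fin 2) F)) →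
        (p : ℤ) * (w₁ * (p ^ 2 + p - 1) - w₂ * p * (p + 1)) * c₀ =
          (p : ℤ) * (w₁ * (p ^ 2 + p - 1) - w₂ * p * (p + 1) - w₁ * (p + 1) ^ 2) * c₁ := by
  classical
  obtain ⟨A, hA⟩ := exists_coordinates F ((p + 2) * w₁ + (p + 1) ^ 2 * w₂) ((p + 1) * w₁)
    ((p + 1) ^ 2 * w₂) ((p + 1) ^ 2 * (p + 2) * w₂) 0 ((p + 1) ^ 3 * w₁) rfl
  -- The zero coordinates, (p + 1)³w₁ in one list and (p + 1)³w₂ in the other, equalise the lengths.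
  obtain ⟨B, hB⟩ := exists_coordinates F ((p + 1) * w₁ + (p + 1) ^ 2 * w₂) ((p + 1) * w₂)
    ((p + 1) ^ 2 * w₁) ((p + 1) * (p + 2) * w₁ + (p + 1) ^ 3 * w₂) (p * (p + 1) * w₁)
    ((p + 1) ^ 3 * w₂)
    (n := ((p + 2) * w₁ + (p + 1) ^ 2 * w₂) * Fintype.card F ^ 3 +
      (p + 1) * w₁ * Fintype.card F ^ 2 + (p + 1) ^ 2 * w₂ * Fintype.card F +
      (p + 1) ^ 2 * (p + 2) * w₂ * Fintype.card F + 0 * Fintype.card F + (p + 1) ^ 3 * w₁)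
    (by rw [hp]; ring)
  have hinj : ∀ {k₀ k₁ k₂ k₃ k₄ n : ℕ} (D : Fin n → Matrix (Fin 3) (Fin 2) F), 0 < k₀ →
      (∀ X : Matrix (Fin 2) (Fin 3) F, ∑ i, rankWeight w₁ w₂ (X * D i) =
        familyWeight w₁ w₂ k₀ k₁ k₂ k₃ k₄ (X.col 0) (X.col 1) (X.col 2)) →
      ∀ X : Matrix (Fin 2) (Fin 3) F, (∀ i, X * D i = 0) → X = 0 := by
    intro k₀ k₁ k₂ k₃ k₄ n D hk hD X hX
    by_contra hX0
    have hpos := familyWeight_pos w₁ w₂ (x := X.col 0) (y := X.col 1) (z := X.col 2) (k₁ := k₁)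
      (k₂ := k₂) (k₃ := k₃) (k₄ := k₄) hk h₁ (by
        rintro ⟨hx, hy, hz⟩
        apply hX0
        ext i j
        fin_cases j
        · exact congrFun hx i
        · exact congrFun hy i
        · exact congrFun hz i)
    rw [← hD X] at hpos
    simp [hX, rankWeight] at hpos
  have hAw := fun X => sum_rankWeight_eq_familyWeight (w₁ := w₁) (w₂ := w₂) hA X
  have hBw := fun X => sum_rankWeight_eq_familyWeight (w₁ := w₁) (w₂ := w₂) hB X
  refine ⟨_, ?_, A, B, ?_, ?_⟩
  · rw [hp]
    have : 0 < (p + 1) ^ 3 * w₁ := by positivity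
    omega
  · rw [weightEnumerator_matrixCode _ A (hinj A (by positivity) hAw),
      weightEnumerator_matrixCode _ B (hinj B (by positivity) hBw)]
    simp only [hAw, hBw]
    -- Each monomial is a function of the weight alone.
    exact sum_comp_weightC_eq_weightD w₁ w₂ hp fun k =>
      MvPolynomial.X 0 ^ (_ * maxWeight (rankWeight (F := F) w₁ w₂) - k) * MvPolynomial.X 1 ^ k
  · intro v c₀ c₁ hv hw hc₀ hc₁ h
    have h0 : rankWeight w₁ w₂ (0 : Matrix (Fin 2) (Fin 2) F) = 0 := by simp [rankWeight]
    have hcount := ncard_eq_of_weightEnumerator_eq h v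
    rw [ncard_rightDual_matrixCode A hv h0 hw, ncard_rightDual_matrixCode B hv h0 hw] at hcount
    have eA := sum_card_mul_eq_zero hp hA (fun r => rankWeight w₁ w₂ r = v)
      (by rw [h0]; exact hv.symm)
    have eB := sum_card_mul_eq_zero hp hB (fun r => rankWeight w₁ w₂ r = v)
      (by rw [h0]; exact hv.symm)
    rw [← Set.ncard_coe_finset, ← Set.ncard_coe_finset] at eA eB
    simp only [Finset.coe_filter, Finset.mem_univ, true_and] at eA eB
    rw [hc₀, hc₁] at eA eB
    rw [hcount] at eA
    zify at eA eB
    linear_combination eB - eA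

/-- A rank-one r generates a left ideal with q² - 1 nonzero elements, all of weight w₁, which fixes
the average; `h` says that the whole ring has the same average. -/
theorem isHomogeneous_rankWeight {w₁ w₂ p : ℕ} (hp : Fintype.card F = p + 1) (hw₁ : 0 < w₁)
    (h : (w₁ : ℝ) * (p ^ 2 + p - 1) = w₂ * p * (p + 1)) :
    IsHomogeneous (w₁ * p * (p + 2) / (p + 1) ^ 2)
      fun r : Matrix (Fin 2) (Fin 2) F => (rankWeight w₁ w₂ r : ℝ) := by
  classical
  have hp0 : 0 < p := by
    have := Fintype.one_lt_card (α := F)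
    omega
  have hsq : (p + 1) ^ 2 - 1 = p * (p + 2) := by
    rw [show (p + 1) ^ 2 = p * (p + 2) + 1 by ring, Nat.add_sub_cancel]
  refine ⟨by positivity, by simp [rankWeight], ?_, fun r hr => ?_⟩
  · rw [eq_top_iff]
    intro u _ r
    have hu : (u : Matrix (Fin 2) (Fin 2) F).det ≠ 0 :=
      ((Matrix.isUnit_iff_isUnit_det _).1 u.isUnit).ne_zero
    simp [rankWeight, Matrix.det_mul, hu]
  by_cases hdet : r.det = 0
  · obtain ⟨c, b, hc, hb, rfl⟩ := exists_vecMulVec_of_det_eq_zero r hr hdet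
    have hinj : Function.Injective fun d : Fin 2 → F => vecMulVec d b := by
      obtain ⟨j, hj⟩ := Function.ne_iff.1 hb
      intro d d' hd
      funext i
      exact mul_right_cancel₀ hj (congrFun (congrFun hd i) j)
    have hset : ((Ideal.span {vecMulVec c b} : Ideal (Matrix (Fin 2) (Fin 2) F)) :
        Set (Matrix (Fin 2) (Fin 2) F)) = Set.range fun d : Fin 2 → F => vecMulVec d b := by
      obtain ⟨j, hj⟩ := Function.ne_iff.1 hc
      ext x
      rw [SetLike.mem_coe, Ideal.mem_span_singleton', Set.mem_range]
      constructor
      · rintro ⟨a, rfl⟩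
        exact ⟨a *ᵥ c, by rw [Matrix.mul_vecMulVec]⟩
      · rintro ⟨d, rfl⟩
        -- This matrix sends `c` to `d`, since `c j` is invertible.
        refine ⟨vecMulVec d (Pi.single j (c j)⁻¹), ?_⟩
        rw [Matrix.mul_vecMulVec]
        congr 1
        ext i
        rw [Matrix.mulVec, dotProduct, Finset.sum_eq_single j]
        · simp only [vecMulVec_apply, Pi.single_eq_same]
          rw [mul_assoc, inv_mul_cancel₀ hj, mul_one]
        · intro k _ hk
          simp [vecMulVec_apply, hk]
        · simp
    have hcard : Nat.card (Ideal.span {vecMulVec c b} : Ideal (Matrix (Fin 2) (Fin 2) F)) =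
        (p + 1) ^ 2 := by
      rw [← SetLike.coe_sort_coe, hset, Nat.card_range_of_injective hinj]
      simp [hp]
    have hval : ∀ d : Fin 2 → F, (rankWeight w₁ w₂ (vecMulVec d b) : ℝ) =
        if d = 0 then 0 else (w₁ : ℝ) := by
      intro d
      have h1 : (vecMulVec d b).det = 0 := by
        rw [Matrix.det_fin_two]
        simp [vecMulVec_apply]
        ring
      have h2 : vecMulVec d b = 0 ↔ d = 0 :=
        ⟨fun h => hinj (by simpa using h), fun h => by simp [h]⟩
      simp only [rankWeight, h1, h2, if_true]
      split_ifs <;> simp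
    rw [hcard]
    change ∑ᶠ x ∈ ((Ideal.span {vecMulVec c b} : Ideal (Matrix (Fin 2) (Fin 2) F)) :
        Set (Matrix (Fin 2) (Fin 2) F)), (rankWeight w₁ w₂ x : ℝ) = _
    rw [hset, finsum_mem_range hinj, finsum_eq_sum_of_fintype]
    simp only [hval]
    have := sum_ite_eq_add (0 : Fin 2 → F) 0 w₁
    simp only [Fintype.card_fun, Fintype.card_fin, hp, zero_add] at this
    have h' : ((∑ u : Fin 2 → F, if u = 0 then 0 else w₁ : ℕ) : ℝ) + w₁ = (p + 1) ^ 2 * w₁ := by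
      exact_mod_cast this
    push_cast at h' ⊢
    rw [div_mul_cancel₀ _ (by positivity)]
    linear_combination h'
  · have hspan : (Ideal.span {r} : Ideal (Matrix (Fin 2) (Fin 2) F)) = ⊤ :=
      Ideal.eq_top_of_isUnit_mem _ (Ideal.mem_span_singleton_self r)
        ((Matrix.isUnit_iff_isUnit_det r).2 (Ne.isUnit hdet))
    have hcard : Nat.card (⊤ : Ideal (Matrix (Fin 2) (Fin 2) F)) = (p + 1) ^ 4 := by
      rw [Nat.card_congr (Submodule.topEquiv (R := Matrix (Fin 2) (Fin 2) F)).toEquiv,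
        Nat.card_congr (Matrix.of (m := Fin 2) (n := Fin 2) (α := F)).symm]
      simp [hp, ← pow_mul]
    rw [hspan, hcard]
    simp only [Submodule.mem_top, finsum_true]
    rw [finsum_eq_sum_of_fintype]
    have hsum : ∑ r : Matrix (Fin 2) (Fin 2) F, rankWeight w₁ w₂ r =
        w₁ * (p * (p + 2) * (p + 2)) + w₂ * (p * (p + 2) * (p * (p + 1))) := by
      have e1 := card_det_eq_zero (F := F)
      have e2 := card_det_ne_zero (F := F)
      have e3 : (p + 1) ^ 2 - (p + 1) = p * (p + 1) := by
        rw [show (p + 1) ^ 2 = p * (p + 1) + (p + 1) by ring, Nat.add_sub_cancel]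
      rw [hp, hsq] at e1 e2
      rw [e3] at e2
      have e4 : ∀ r : Matrix (Fin 2) (Fin 2) F, rankWeight w₁ w₂ r =
          (if r ≠ 0 ∧ r.det = 0 then w₁ else 0) + if r.det ≠ 0 then w₂ else 0 := by
        intro r
        unfold rankWeight
        by_cases h1 : r = 0
        · simp [h1]
        · by_cases h2 : r.det = 0 <;> simp [h1, h2]
      simp only [e4]
      rw [Finset.sum_add_distrib, ← Finset.sum_filter, ← Finset.sum_filter, Finset.sum_const,
        Finset.sum_const, e1, e2, smul_eq_mul, smul_eq_mul]
      ring
    rw [← Nat.cast_sum, hsum]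
    push_cast
    rw [show ((p : ℝ) + 1) ^ 4 = (p + 1) ^ 2 * (p + 1) ^ 2 by ring, ← mul_assoc (_ / _),
      div_mul_cancel₀ _ (by positivity)]
    linear_combination -((p : ℝ) * (p + 2)) * h

end RingWeight

/-! ### The main theorem. -/

theorem mainTheorem2 {F : Type*} [Field F] [Finite F]
    (w : Matrix (Fin 2) (Fin 2) F → ℕ)
    (hw_zero : w 0 = 0)
    (hw_pos : ∀ r, r ≠ 0 → 0 < w r)
    (hw_sym : RingWeight.HasMaximalSymmetry w)
    (hw_hamming : ¬ RingWeight.IsMultipleOf w (RingWeight.hamming (Matrix (Fin 2) (Fin 2) F)))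
    (hw_homogeneous : Nat.card F = 2 →
      ¬ ∃ (ζ : ℝ) (h : Matrix (Fin 2) (Fin 2) F → ℝ),
        RingWeight.IsHomogeneous ζ h ∧ RingWeight.IsMultipleOf w h) :
    ¬ RingWeight.RespectsDuality w := by
  have : Fintype F := Fintype.ofFinite F
  obtain ⟨p, hp⟩ : ∃ p, Fintype.card F = p + 1 := ⟨_, (Nat.succ_pred Fintype.card_ne_zero).symm⟩
  have hp0 : 0 < p := by
    have := Fintype.one_lt_card (α := F)
    omega
  have hE : (!![1, 0; 0, 0] : Matrix (Fin 2) (Fin 2) F) ≠ 0 := fun h => by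
    simpa using congrFun (congrFun h 0) 0
  have h₁ := hw_pos _ hE
  have h₂ := hw_pos 1 one_ne_zero
  have hw := hw_sym.eq_rankWeight hw_zero
  set w₁ := w !![1, 0; 0, 0]
  set w₂ := w 1
  clear_value w₁ w₂
  subst hw
  have hne : w₁ ≠ w₂ := by
    rintro rfl
    refine hw_hamming ⟨w₁, fun r => ?_⟩
    unfold RingWeight.hamming rankWeight
    split_ifs <;> simp
  have hmin : ∀ r : Matrix (Fin 2) (Fin 2) F, r ≠ 0 →
      rankWeight w₁ w₂ r = w₁ ∨ rankWeight w₁ w₂ r = w₂ := by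
    intro r hr
    unfold rankWeight
    rw [if_neg hr]
    split_ifs <;> simp
  intro hdual
  obtain ⟨n, hn, A, B, hAB, key⟩ := RingWeight.exists_codes (F := F) w₁ w₂ h₁ h₂ hp
  replace key := fun v c₀ c₁ a b c d => key v c₀ c₁ a b c d (hdual n hn _ _ hAB)
  have hsq : (p + 1) ^ 2 - 1 = p * (p + 2) := by
    rw [show (p + 1) ^ 2 = p * (p + 2) + 1 by ring, Nat.add_sub_cancel]
  -- For v = w₁ the counts satisfy c₀ = (p + 2)c₁.
  have key₁ : w₁ < 2 * w₂ → ((p : ℤ) + 2) * w₁ = (p + 1) * w₂ := by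
    classical
    intro hlt
    have e₀ : {r : Matrix (Fin 2) (Fin 2) F | rankWeight w₁ w₂ r = w₁}.ncard =
        p * (p + 2) * (p + 2) := by
      have := card_det_eq_zero (F := F)
      rw [hp, hsq, ← Set.ncard_coe_finset] at this
      rw [← this]
      congr 1
      ext r
      unfold rankWeight
      by_cases h1 : r = 0
      · simp [h1, h₁.ne]
      · by_cases h2 : r.det = 0 <;> simp [h1, h2, hne.symm]
    have e₁ : {r : Matrix (Fin 2) (Fin 2) F | r 0 = 0 ∧ rankWeight w₁ w₂ r = w₁}.ncard =
        p * (p + 2) := by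
      have := card_row_zero_eq_zero (F := F)
      rw [hp, hsq, ← Set.ncard_coe_finset] at this
      rw [← this]
      congr 1
      ext r
      unfold rankWeight
      by_cases h0 : r 0 = 0
      · have h2 : r.det = 0 := Matrix.det_eq_zero_of_row_eq_zero 0 (congrFun h0)
        by_cases h1 : r = 0
        · simp [h1, h₁.ne]
        · simp [h0, h1, h2]
      · simp [h0]
    have := key w₁ _ _ h₁.ne' (fun r hr => by rcases hmin r hr with h | h <;> omega) e₀ e₁
    push_cast at this
    have hpos : ((p : ℤ) * (p * (p + 2)) * (p + 1) * p) ≠ 0 := by positivity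
    refine mul_left_cancel₀ hpos ?_
    linear_combination this
  -- For v = w₂ the count c₁ is 0, because a zero first row forces rank at most one. This covers the
  -- degenerate case q w₂ = (q + 1)w₁, where `key₁` gives no contradiction.
  have key₂ : w₂ < 2 * w₁ → (w₁ : ℤ) * (p ^ 2 + p - 1) = w₂ * p * (p + 1) := by
    classical
    intro hlt
    have e₀ : {r : Matrix (Fin 2) (Fin 2) F | rankWeight w₁ w₂ r = w₂}.ncard ≠ 0 := by
      exact ((Set.ncard_pos (Set.toFinite _)).2 ⟨1, by simp [rankWeight]⟩).ne'
    have e₁ : {r : Matrix (Fin 2) (Fin 2) F | r 0 = 0 ∧ rankWeight w₁ w₂ r = w₂}.ncard = 0 := by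
      rw [Set.ncard_eq_zero, Set.eq_empty_iff_forall_notMem]
      rintro r ⟨h0, hr⟩
      have h2 : r.det = 0 := Matrix.det_eq_zero_of_row_eq_zero 0 (congrFun h0)
      unfold rankWeight at hr
      split_ifs at hr
      · exact h₂.ne hr
      · exact hne hr
    have := key w₂ _ _ h₂.ne' (fun r hr => by rcases hmin r hr with h | h <;> omega) rfl e₁
    rw [Nat.cast_zero, mul_zero, mul_eq_zero, mul_eq_zero] at this
    rcases this with (h | h) | h
    · exact absurd h (by positivity)
    · exact sub_eq_zero.1 h
    · exact absurd h (by exact_mod_cast e₀)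
  have hp0' : (0 : ℤ) < p := by exact_mod_cast hp0
  have h₁' : (0 : ℤ) < w₁ := by exact_mod_cast h₁
  by_cases hlt : w₁ < 2 * w₂
  · have hd := key₁ hlt
    have hd' : w₂ < 2 * w₁ := by
      have : ((p : ℤ) + 1) * w₂ < (p + 1) * (2 * w₁) := by
        rw [← hd]
        nlinarith
      exact_mod_cast lt_of_mul_lt_mul_left this (by positivity)
    have h := key₂ hd'
    have : (w₁ : ℤ) * (p + 1) = 0 := by linear_combination (p : ℤ) * hd - h
    exact absurd this (by positivity)
  · have h := key₂ (by omega)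
    have hle : 2 * (w₂ : ℤ) ≤ w₁ := by omega
    -- With 2w₂ ≤ w₁ the homogeneous ratio yields p(p + 1) ≤ 2.
    have hp1 : p = 1 := by
      by_contra hp1
      have hp2 : (2 : ℤ) ≤ p := by omega
      have h3 : 2 * (w₂ : ℤ) * (p * (p + 1)) ≤ w₁ * (p * (p + 1)) :=
        mul_le_mul_of_nonneg_right hle (by positivity)
      have h4 : (0 : ℤ) < w₁ * (p ^ 2 + p - 2) := mul_pos h₁' (by nlinarith)
      linarith
    refine hw_homogeneous ?_ ⟨_, _, RingWeight.isHomogeneous_rankWeight (w₂ := w₂) hp h₁ ?_, 1, fun r => ?_⟩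
    · rw [Nat.card_eq_fintype_card, hp, hp1]
    · exact_mod_cast h
    · rw [one_mul]
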